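/- Let $d\ge 0$ and let $K:\mathbb R^d\to\mathbb C$ be a continuous function in $L^1(\mathbb R^d)$ whose Fourier transform $\hat K(z)=\int_{\mathbb R^d}e^{-2\pi i z\cdot x}K(x)\,dx$ satisfies, for some constants $a,b,\gamma_1,\gamma_2>0$, $$\hat K(z)\ \ge\ \frac{a}{\left(1+b\|z\|^{\gamma_1}\right)^{\gamma_2}}\qquad\text{for all } z\in\mathbb R^d$$ (in particular $\hat K$ is real valued). Then: (i) The translation invariant kernel $(x,y)\mapsto K(x-y)$ on $\mathbb R^d$ is continuous and positive definite, i.e. $\sum_{i,j=1}^N c_i\overline{c_j}\,K(x_j-x_i)\ge 0$ for all $N$, all $x_1,\dots,x_N\in\mathbb R^d$ and all $c_1,\dots,c_N\in\mathbb C$. Let $\mathcal H$ be its reproducing kernel Hilbert space, a Hilbert space of functions $\mathbb R^d\to\mathbb C$, and for $x\in\mathbb R^d$ let $K_x\in\mathcal H$ be the function $K_x(y)=K(y-x)$, so that $f(x)=\langle f,K_x\rangle$ for all $f\in\mathcal H$. Put $d_K(x,y)=\|K_x-K_y\|_{\mathcal H}=\sqrt{2K(0)-2\operatorname{Re}K(x-y)}$.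 (ii) $d_K$ is a metric on $\mathbb R^d$, and the topology it induces coincides with the Euclidean topology. (iii) The kernel is completely separating: $K_x\ne K_y$ whenever $x\neq y$, and for every subset $C\subset\mathbb R^d$ that is closed with respect to $d_K$ and every $x\notin C$ there is $f\in\mathcal H$ with $f(x)\ne 0$ and $f(y)=0$ for all $y\in C$. -/

import Mathlib

open scoped Topology FourierTransform ComplexOrder InnerProductSpace

noncomputable section

namespace SeparatingKernel

variable {X : Type*}

/-- A complex kernel `K : X × X → ℂ` is positive definite (of positive type) if
`∑ᵢⱼ conj (cᵢ) K (xᵢ, xⱼ) cⱼ ≥ 0` for all finite families of points and complex coefficients. -/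
abbrev IsPositiveDefinite (K : X → X → ℂ) : Prop :=
  (Matrix.of K).PosSemidef

/-- The scalar kernel `K`, with the number `K x y` seen as an operator on `ℂ`. -/
def opKernel (K : X → X → ℂ) : Matrix X X (ℂ →L[ℂ] ℂ) :=
  Matrix.of fun x y => K x y • (1 : ℂ →L[ℂ] ℂ)

theorem opKernel_posSemidef {K : X → X → ℂ} (hK : IsPositiveDefinite K) :
    (opKernel K).PosSemidef := by
  have hH : (opKernel K).IsHermitian := by
    ext x y
    have h := hK.isHermitian.apply x y
    simp only [Matrix.of_apply] at h
    simp [opKernel, Matrix.conjTranspose_apply, ← h]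
  refine ((RKHS.posSemidef_tfae (K := opKernel K)).out 0 2).mpr (And.intro hH fun v => ?_)
  have h := hK.2 v
  rw [Finsupp.sum_comm] at h
  have h' := (Complex.le_def.1 h).1
  refine le_of_le_of_eq h' ?_
  simp only [Finsupp.sum, Complex.re_sum, map_sum, RCLike.re_to_complex]
  refine Finset.sum_congr rfl fun x _ => Finset.sum_congr rfl fun y _ => ?_
  have e : star (v y) * K y x * v x
      = (starRingEnd ℂ) (⟪opKernel K y x (v x), v y⟫_ℂ) := by
    simp [opKernel]
    ring
  simp only [Matrix.of_apply]
  rw [e, Complex.conj_re]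

section General

/-! Notions attached to a reproducing kernel Hilbert space `H` of complex functions on `X`. -/

variable (H : Type*) [NormedAddCommGroup H] [InnerProductSpace ℂ H] [CompleteSpace H]
  [RKHS ℂ H X ℂ]

/-- The element `K_x` of `H`, characterized by `f x = ⟨f, K_x⟩`; as a function,
`K_x y = K y x`. -/
def kernelVector (x : X) : H := RKHS.kerFun H x (1 : ℂ)

/-- The (pseudo)metric `d_K x y = ‖K_x - K_y‖` on `X`. -/
abbrev kernelMetricOf : PseudoMetricSpace X :=
  PseudoMetricSpace.induced (kernelVector H) inferInstance

/-- `H` separates `C` if for every `x ∉ C` some `f ∈ H` vanishes on `C` but not at `x`. -/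
def SeparatesOf (C : Set X) : Prop :=
  ∀ x, x ∉ C → ∃ f : H, f x ≠ 0 ∧ ∀ y ∈ C, f y = 0

/-- `H` is completely separating if `x ↦ K_x` is injective and `H` separates every subset of
`X` that is closed with respect to `d_K`. -/
def CompletelySeparatingOf : Prop :=
  Function.Injective (kernelVector (X := X) H) ∧
    ∀ C : Set X, IsClosed[(kernelMetricOf H).toUniformSpace.toTopologicalSpace] C →
      SeparatesOf H C

end General

section Kernel

/-! The same notions for a positive definite kernel `K`, through its reproducing kernel
Hilbert space. -/

variable {K : X → X → ℂ} (hK : IsPositiveDefinite K)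

/-- The (pseudo)metric `d_K` of a positive definite kernel `K`. -/
abbrev kernelMetric : PseudoMetricSpace X :=
  haveI : Fact (opKernel K).PosSemidef := ⟨opKernel_posSemidef hK⟩
  kernelMetricOf (RKHS.OfKernel (opKernel K))

/-- The topology on `X` induced by `d_K`. -/
abbrev kernelTopology : TopologicalSpace X :=
  (kernelMetric hK).toUniformSpace.toTopologicalSpace

/-- The reproducing kernel Hilbert space of `K` is completely separating. -/
def CompletelySeparating : Prop :=
  haveI : Fact (opKernel K).PosSemidef := ⟨opKernel_posSemidef hK⟩
  CompletelySeparatingOf (RKHS.OfKernel (opKernel K))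

/-- The explicit formula for `d_K`. -/
theorem kernelMetric_dist (x y : X) :
    (kernelMetric hK).dist x y = √((K x x).re + (K y y).re - 2 * (K x y).re) := by
  have : Fact (opKernel K).PosSemidef := ⟨opKernel_posSemidef hK⟩
  have key : ∀ x y : X,
      ⟪kernelVector (RKHS.OfKernel (opKernel K)) x,
        kernelVector (RKHS.OfKernel (opKernel K)) y⟫_ℂ = K x y := by
    intro x y
    simp only [kernelVector]
    rw [RKHS.kerFun_inner, RKHS.kerFun_apply, RKHS.OfKernel.kernel_ofKernel]
    simp [opKernel]
  have h := @norm_sub_sq ℂ _ _ _ _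
    (kernelVector (RKHS.OfKernel (opKernel K)) x)
    (kernelVector (RKHS.OfKernel (opKernel K)) y)
  rw [@norm_sq_eq_re_inner ℂ _ _ _ _ (kernelVector _ x),
    @norm_sq_eq_re_inner ℂ _ _ _ _ (kernelVector _ y), key, key, key] at h
  simp only [RCLike.re_to_complex] at h
  change dist (kernelVector (RKHS.OfKernel (opKernel K)) x)
    (kernelVector (RKHS.OfKernel (opKernel K)) y) = _
  rw [dist_eq_norm, ← Real.sqrt_sq (norm_nonneg _), h]
  congr 1
  ring

end Kernel

end SeparatingKernel

end

/-! A continuous integrable function with nonnegative Fourier transform has integrable transform, so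
Fourier inversion holds everywhere. With r = 𝓕 K it exhibits K (x - y) as the Gram matrix of e_x =
√r e^{-2πi z·x} in L², which gives positive definiteness. The functions y ↦ ⟨e_y, g⟩ with g in L²
all belong to the RKHS. The polynomial lower bound on r makes g = 𝓕 φ / √r square integrable for
every Schwartz φ, and this g yields φ itself. Hence the RKHS contains bump functions and separates
Euclidean-closed sets. Together with continuity of x ↦ K_x, this identifies the two topologies, and
complete separation follows. -/

theorem exists_inner_eq_of_inner_eq {X 𝕜 H L : Type*} [RCLike 𝕜]
    [NormedAddCommGroup H] [InnerProductSpace 𝕜 H] [CompleteSpace H]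
    [NormedAddCommGroup L] [InnerProductSpace 𝕜 L] [CompleteSpace L]
    (k : X → H) (e : X → L) (h : ∀ x y, inner 𝕜 (k x) (k y) = inner 𝕜 (e x) (e y)) (g : L) :
    ∃ f : H, ∀ x, inner 𝕜 (k x) f = inner 𝕜 (e x) g := by
  -- Work in the closed span S of the pairs (k x, e x), the graph of the partial isometry k x ↦ e x.
  -- On S both components have the same pairing with the point x.
  let p : X → WithLp 2 (H × L) := fun x => WithLp.toLp 2 (k x, e x)
  let S := (Submodule.span 𝕜 (Set.range p)).topologicalClosure
  have hp : ∀ x, p x ∈ S := fun x =>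
    Submodule.le_topologicalClosure _ (Submodule.subset_span ⟨x, rfl⟩)
  have hS : ∀ u ∈ S, ∀ x, inner 𝕜 (k x) u.fst = inner 𝕜 (e x) u.snd := by
    intro u hu x
    have hcl : IsClosed {u : WithLp 2 (H × L) | inner 𝕜 (k x) u.fst = inner 𝕜 (e x) u.snd} :=
      isClosed_eq (by fun_prop) (by fun_prop)
    refine closure_minimal (fun v hv => ?_) hcl hu
    refine Submodule.span_induction ?_ ?_ ?_ ?_ hv
    · rintro _ ⟨y, rfl⟩
      exact h x y
    · simp
    · intro v w _ _ hv hw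
      simp only [Set.mem_ofPred_eq] at hv hw ⊢
      simp [inner_add_right, hv, hw]
    · intro c v _ hv
      simp only [Set.mem_ofPred_eq] at hv ⊢
      simp [inner_smul_right, hv]
  have : CompleteSpace S := (Submodule.isClosed_topologicalClosure _).completeSpace_coe
  let q : WithLp 2 (H × L) := WithLp.toLp 2 (0, g)
  let u : WithLp 2 (H × L) := S.starProjection q
  have hu : u ∈ S := S.starProjection_apply_mem q
  -- Since (0, g) - u is orthogonal to p x, the two equal pairings of u add up to ⟨e x, g⟩; hence
  -- the factor 2.
  refine ⟨(2 : 𝕜) • u.fst, fun x => ?_⟩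
  have h1 : inner 𝕜 (p x) (q - u) = 0 :=
    (Submodule.mem_orthogonal S _).1 (S.sub_starProjection_mem_orthogonal q) _ (hp x)
  rw [inner_sub_right, WithLp.prod_inner_apply, WithLp.prod_inner_apply] at h1
  have h2 := hS u hu x
  simp only [p, q, inner_zero_right, zero_add] at h1
  rw [inner_smul_right]
  have h3 : inner 𝕜 (k x) (u.fst) = inner 𝕜 (k x) u.ofLp.fst := rfl
  have h4 : inner 𝕜 (e x) (u.snd) = inner 𝕜 (e x) u.ofLp.snd := rfl
  rw [← h3, ← h4, ← h2] at h1
  linear_combination -h1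

/-! ### Integrability of a nonnegative Fourier transform -/

open MeasureTheory in
theorem continuous_fourier_of_integrable {V : Type*} [NormedAddCommGroup V]
    [InnerProductSpace ℝ V] [FiniteDimensional ℝ V] [MeasurableSpace V] [BorelSpace V]
    {f : V → ℂ} (hf : Integrable f) : Continuous (𝓕 f) :=
  VectorFourier.fourierIntegral_continuous Real.continuous_fourierChar
    (L := innerₗ V) continuous_inner hf

open MeasureTheory Filter in
/-- Gaussian summation of the Fourier integral of a function at a point of continuity. -/
theorem tendsto_integral_gaussian_smul_fourier {V : Type*} [NormedAddCommGroup V]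
    [InnerProductSpace ℝ V] [FiniteDimensional ℝ V] [MeasurableSpace V] [BorelSpace V]
    {f : V → ℂ} (hf : Integrable f) (h0 : ContinuousAt f 0) :
    Tendsto (fun c : ℝ => ∫ w, Complex.exp (-(c⁻¹ : ℝ) * (‖w‖ : ℂ) ^ 2) • 𝓕 f w) atTop
      (𝓝 (f 0)) := by
  refine (Real.tendsto_integral_gaussian_smul' hf h0).congr' ?_
  filter_upwards [Ioi_mem_atTop 0] with c (hc : 0 < c)
  have hre : 0 < ((c⁻¹ : ℝ) : ℂ).re := by simpa using hc
  have J : Integrable (fun w : V => Complex.exp (-(c⁻¹ : ℝ) * (‖w‖ : ℂ) ^ 2)) := by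
    simpa using GaussianFourier.integrable_cexp_neg_mul_sq_norm_add hre 0 (0 : V)
  have key := VectorFourier.integral_fourierIntegral_smul_eq_flip (L := innerₗ V)
    Real.continuous_fourierChar continuous_inner J hf
  rw [flip_innerₗ] at key
  refine Eq.trans ?_ key
  congr with w
  congr 1
  change _ = 𝓕 (fun w : V => Complex.exp (-(c⁻¹ : ℝ) * (‖w‖ : ℂ) ^ 2)) w
  rw [fourier_gaussian_innerProductSpace hre]
  congr 1
  · simp
  · simp; ring_nf

-- By nonnegativity, the Gaussian-weighted integrals of 𝓕 f are also L¹ norms; they converge to f 0,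
-- so Fatou's lemma bounds the L¹ norm of 𝓕 f by |f 0|.
open MeasureTheory Filter in
theorem integrable_fourier_of_nonneg {V : Type*} [NormedAddCommGroup V]
    [InnerProductSpace ℝ V] [FiniteDimensional ℝ V] [MeasurableSpace V] [BorelSpace V]
    {f : V → ℂ} (hf : Integrable f) (h0 : ContinuousAt f 0) (hpos : ∀ z, 0 ≤ 𝓕 f z) :
    Integrable (𝓕 f) := by
  have hc := continuous_fourier_of_integrable hf
  refine ⟨hc.aestronglyMeasurable, ?_⟩
  -- At n = 0 the convention 0⁻¹ = 0 makes the weight 1, so integrability of `G n` is claimed only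
  -- for n > 0.
  let G : ℕ → V → ℂ := fun n w => Complex.exp (-(((n : ℝ))⁻¹ : ℝ) * (‖w‖ : ℂ) ^ 2) • 𝓕 f w
  have hG : ∀ n, Continuous (G n) := fun n => by fun_prop
  have hlim : ∀ w, Tendsto (fun n => ‖G n w‖ₑ) atTop (𝓝 ‖𝓕 f w‖ₑ) := by
    intro w
    refine (Tendsto.enorm ?_)
    have h1 : Tendsto (fun n : ℕ => Complex.exp (-((((n : ℝ))⁻¹ : ℝ) : ℂ) * (‖w‖ : ℂ) ^ 2)) atTop
        (𝓝 (Complex.exp (-((0 : ℝ) : ℂ) * (‖w‖ : ℂ) ^ 2))) := by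
      refine Tendsto.cexp (Tendsto.mul_const _ (Tendsto.neg ?_))
      exact (Complex.continuous_ofReal.tendsto _).comp
        (tendsto_inv_atTop_zero.comp tendsto_natCast_atTop_atTop)
    simpa [G] using h1.mul_const (𝓕 f w)
  have hGnn : ∀ n w, 0 ≤ G n w := by
    intro n w
    refine mul_nonneg ?_ (hpos w)
    rw [show -((((n : ℝ))⁻¹ : ℝ) : ℂ) * (‖w‖ : ℂ) ^ 2 = ((-((n : ℝ))⁻¹ * ‖w‖ ^ 2 : ℝ) : ℂ) by
      push_cast; ring, ← Complex.ofReal_exp]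
    exact_mod_cast (Real.exp_pos _).le
  have hGint : ∀ n : ℕ, 0 < n → Integrable (G n) := by
    intro n hn
    have J : Integrable (fun w : V => Complex.exp (-(((n : ℝ))⁻¹ : ℝ) * (‖w‖ : ℂ) ^ 2)) := by
      have hre : 0 < ((((n : ℝ))⁻¹ : ℝ) : ℂ).re := by
        rw [Complex.ofReal_re]; positivity
      simpa using GaussianFourier.integrable_cexp_neg_mul_sq_norm_add hre 0 (0 : V)
    refine J.mul_bdd (c := ∫ v, ‖f v‖) hc.aestronglyMeasurable (ae_of_all _ fun w => ?_)
    exact VectorFourier.norm_fourierIntegral_le_integral_norm _ _ _ _ _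
  have hval : ∀ n : ℕ, 0 < n → ∫⁻ w, ‖G n w‖ₑ = ‖∫ w, G n w‖ₑ := by
    intro n hn
    have hre : ∀ w, G n w = ((‖G n w‖ : ℝ) : ℂ) := fun w =>
      (RCLike.norm_of_nonneg' (K := ℂ) (hGnn n w)).symm
    have hI : ∫ w, G n w = ((∫ w, ‖G n w‖ : ℝ) : ℂ) :=
      (integral_congr_ae (ae_of_all _ hre)).trans integral_ofReal
    rw [hI, ← ofReal_integral_norm_eq_lintegral_enorm (hGint n hn),
      ← ofReal_norm, Complex.norm_real,
      Real.norm_of_nonneg (integral_nonneg fun _ => norm_nonneg _)]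
  have hT : Tendsto (fun n : ℕ => ∫⁻ w, ‖G n w‖ₑ) atTop (𝓝 ‖f 0‖ₑ) := by
    refine Tendsto.congr' ?_ (((tendsto_integral_gaussian_smul_fourier hf h0).comp
      tendsto_natCast_atTop_atTop).enorm)
    filter_upwards [eventually_gt_atTop 0] with n hn
    exact (hval n hn).symm
  calc ∫⁻ w, ‖𝓕 f w‖ₑ = ∫⁻ w, liminf (fun n => ‖G n w‖ₑ) atTop := by
        simp_rw [fun w => (hlim w).liminf_eq]
    _ ≤ liminf (fun n => ∫⁻ w, ‖G n w‖ₑ) atTop :=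
        lintegral_liminf_le fun n => (hG n).enorm.measurable
    _ = ‖f 0‖ₑ := hT.liminf_eq
    _ < ⊤ := enorm_lt_top

/-! ### The feature map in L² -/

/-- The majorant is smooth in z for r = ‖z‖ and of temperate growth, so it multiplies Schwartz
functions; ‖z‖ ^ γ₁ need not be smooth at 0. -/
theorem rpow_bound {b γ₁ γ₂ r : ℝ} (hb : 0 < b) (hγ₁ : 0 < γ₁) (hγ₂ : 0 < γ₂) (hr : 0 ≤ r) :
    (1 + b * r ^ γ₁) ^ γ₂ ≤ (1 + b) ^ γ₂ * (1 + r ^ 2) ^ (γ₁ * γ₂) := by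
  have h1 : r ≤ 1 + r ^ 2 := by nlinarith [sq_nonneg (r - 1)]
  have h2 : r ^ γ₁ ≤ (1 + r ^ 2) ^ γ₁ := Real.rpow_le_rpow hr h1 hγ₁.le
  have h3 : 1 ≤ (1 + r ^ 2) ^ γ₁ := Real.one_le_rpow (by nlinarith) hγ₁.le
  rw [Real.rpow_mul (by positivity), ← Real.mul_rpow (by positivity) (by positivity)]
  refine Real.rpow_le_rpow (by positivity) ?_ hγ₂.le
  nlinarith

open MeasureTheory in
/-- Division of a Schwartz function by the square root of a continuous function bounded below by
the inverse of a power of `1 + b ‖z‖ ^ γ₁` gives a square integrable function. -/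
theorem memLp_schwartz_div_sqrt {V : Type*} [NormedAddCommGroup V] [InnerProductSpace ℝ V]
    [FiniteDimensional ℝ V] [MeasurableSpace V] [BorelSpace V]
    {r : V → ℝ} (hr : Continuous r) {a b γ₁ γ₂ : ℝ}
    (ha : 0 < a) (hb : 0 < b) (hγ₁ : 0 < γ₁) (hγ₂ : 0 < γ₂)
    (h : ∀ z, a / (1 + b * ‖z‖ ^ γ₁) ^ γ₂ ≤ r z) (ψ : SchwartzMap V ℂ) :
    MemLp (fun z => ψ z / (√(r z) : ℂ)) 2 := by
  have hpos : ∀ z, 0 < r z := fun z => lt_of_lt_of_le (by positivity) (h z)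
  have hT := Function.hasTemperateGrowth_one_add_norm_sq_rpow V (γ₁ * γ₂)
  let θ : SchwartzMap V ℂ := SchwartzMap.smulLeftCLM ℂ (fun x : V => (1 + ‖x‖ ^ 2) ^ (γ₁ * γ₂)) ψ
  have hθ : ∀ z, θ z = ((1 + ‖z‖ ^ 2) ^ (γ₁ * γ₂) : ℝ) • ψ z :=
    fun z => SchwartzMap.smulLeftCLM_apply_apply hT ψ z
  -- The extra 1 ensures C * D ≥ 1, so that r⁻¹ ≤ C * D ≤ (C * D)² also bounds (√r)⁻¹.
  set C : ℝ := 1 + (1 + b) ^ γ₂ / a with hC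
  have hC1 : 1 ≤ C := le_add_of_nonneg_right (by positivity)
  refine MemLp.of_le_mul (c := C) (θ.memLp 2) ?_ (ae_of_all _ fun z => ?_)
  · refine Continuous.aestronglyMeasurable (ψ.continuous.div (by fun_prop) fun z => ?_)
    exact_mod_cast (Real.sqrt_pos.2 (hpos z)).ne'
  · set D : ℝ := (1 + ‖z‖ ^ 2) ^ (γ₁ * γ₂) with hD
    have hD1 : 1 ≤ D := Real.one_le_rpow (by nlinarith [sq_nonneg ‖z‖]) (by positivity)
    have hB := rpow_bound hb hγ₁ hγ₂ (norm_nonneg z)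
    have h1 : (r z)⁻¹ ≤ C * D := by
      have h2 : (r z)⁻¹ ≤ (a / (1 + b * ‖z‖ ^ γ₁) ^ γ₂)⁻¹ := inv_anti₀ (by positivity) (h z)
      rw [inv_div] at h2
      have h3 : (1 + b * ‖z‖ ^ γ₁) ^ γ₂ / a ≤ (1 + b) ^ γ₂ / a * D := by
        rw [div_mul_eq_mul_div]; gcongr
      nlinarith
    have h4 : 1 ≤ C * D := one_le_mul_of_one_le_of_one_le hC1 hD1
    have h5 : (√(r z))⁻¹ ≤ C * D := by
      rw [← Real.sqrt_inv]
      exact Real.sqrt_le_iff.2 ⟨by linarith, by nlinarith⟩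
    rw [hθ, norm_div, norm_smul, Complex.norm_real,
      Real.norm_of_nonneg (Real.sqrt_nonneg _), Real.norm_of_nonneg (by linarith : 0 ≤ D)]
    calc ‖ψ z‖ / √(r z) = (√(r z))⁻¹ * ‖ψ z‖ := by rw [div_eq_inv_mul]
      _ ≤ C * D * ‖ψ z‖ := by gcongr
      _ = C * (D * ‖ψ z‖) := by ring

theorem posSemidef_of_inner {X H : Type*} [NormedAddCommGroup H] [InnerProductSpace ℂ H]
    (v : X → H) : (Matrix.of fun x y => ⟪v x, v y⟫_ℂ).PosSemidef := by
  refine ⟨?_, fun c => ?_⟩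
  · ext x y
    simp [Matrix.conjTranspose_apply]
  · have : (c.sum fun i ci => c.sum fun j cj => star ci * ⟪v i, v j⟫_ℂ * cj)
        = ⟪c.sum fun i ci => ci • v i, c.sum fun i ci => ci • v i⟫_ℂ := by
      simp only [Finsupp.sum, sum_inner]
      refine Finset.sum_congr rfl fun i _ => ?_
      rw [inner_sum]
      refine Finset.sum_congr rfl fun j _ => ?_
      rw [inner_smul_left, inner_smul_right, RCLike.star_def]; ring
    simp only [Matrix.of_apply]
    rw [this]
    exact (RCLike.nonneg_iff (K := ℂ)).2 ⟨inner_self_nonneg, inner_self_im _⟩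

open MeasureTheory in
/-- If the Fourier transform of `K` is nonnegative, `K (x - y)` is the Gram matrix of the functions
`z ↦ √(𝓕 K z) e^{-2πi z·x}` in `L²`. -/
theorem exists_featureMap {V : Type*} [NormedAddCommGroup V] [InnerProductSpace ℝ V]
    [FiniteDimensional ℝ V] [MeasurableSpace V] [BorelSpace V] {K : V → ℂ} (hK : Continuous K)
    (hint : Integrable K) (hF : Integrable (𝓕 K)) {r : V → ℝ} (hr : Continuous r)
    (hr0 : ∀ z, 0 ≤ r z) (hrK : ∀ z, 𝓕 K z = r z) :
    ∃ e : V → Lp ℂ 2 (volume : Measure V),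
      (∀ x, e x =ᵐ[volume] fun z => 𝐞 (-⟪z, x⟫_ℝ) • (√(r z) : ℂ)) ∧
      ∀ x y, ⟪e x, e y⟫_ℂ = K (x - y) := by
  have hmem : ∀ x : V, MemLp (fun z => 𝐞 (-⟪z, x⟫_ℝ) • (√(r z) : ℂ)) 2 (volume : Measure V) := by
    intro x
    have hc : Continuous (fun z : V => 𝐞 (-⟪z, x⟫_ℝ) • (√(r z) : ℂ)) := by fun_prop
    rw [memLp_two_iff_integrable_sq_norm hc.aestronglyMeasurable]
    refine hF.norm.congr (ae_of_all _ fun z => ?_)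
    simp [hrK, Circle.norm_smul, abs_of_nonneg, hr0 z]
  refine ⟨fun x => (hmem x).toLp _, fun x => (hmem x).coeFn_toLp, fun x y => ?_⟩
  rw [L2.inner_def, ← hint.fourierInv_fourier_eq hF hK.continuousAt, Real.fourierInv_eq]
  refine integral_congr_ae ?_
  filter_upwards [(hmem x).coeFn_toLp, (hmem y).coeFn_toLp] with z hx hy
  rw [hx, hy, hrK, RCLike.inner_apply]
  simp only [Circle.smul_def, smul_eq_mul, map_mul, Complex.conj_ofReal, ← Circle.coe_inv_eq_conj,
    ← AddChar.map_neg_eq_inv, neg_neg]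
  rw [inner_sub_right, sub_eq_add_neg, AddChar.map_add_eq_mul, Circle.coe_mul]
  have : (√(r z) : ℂ) * √(r z) = r z := by exact_mod_cast Real.mul_self_sqrt (hr0 z)
  rw [← this]; ring

/-! ### Separation of closed sets and the kernel topology -/

namespace SeparatingKernel

theorem inner_kernelVector {X H : Type*} [NormedAddCommGroup H] [InnerProductSpace ℂ H]
    [CompleteSpace H] [RKHS ℂ H X ℂ] (x : X) (f : H) : ⟪kernelVector H x, f⟫_ℂ = f x := by
  simp [kernelVector, RKHS.kerFun_inner]

/-- A separated set is an intersection of zero sets of elements of H, which are continuous for d_K.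
-/
theorem isClosed_kernelMetricOf_of_separates {X H : Type*} [NormedAddCommGroup H]
    [InnerProductSpace ℂ H] [CompleteSpace H] [RKHS ℂ H X ℂ] {C : Set X} (hC : SeparatesOf H C) :
    IsClosed[(kernelMetricOf (X := X) H).toUniformSpace.toTopologicalSpace] C := by
  let _ : PseudoMetricSpace X := kernelMetricOf H
  have hcont : ∀ f : H, Continuous (fun x : X => f x) := by
    intro f
    have hk : Continuous (kernelVector (X := X) H) := continuous_induced_dom
    simp_rw [← inner_kernelVector]
    fun_prop
  have : C = ⋂ f : {f : H // ∀ y ∈ C, f y = 0}, {x | (f : H) x = 0} := by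
    ext x
    simp only [Set.mem_iInter, Set.mem_ofPred_eq, Subtype.forall]
    refine ⟨fun hx f hf => hf x hx, fun h => ?_⟩
    by_contra hx
    obtain ⟨f, hf, hf0⟩ := hC x hx
    exact hf (h f hf0)
  rw [this]
  exact isClosed_iInter fun f => isClosed_eq (hcont f) continuous_const

/-- A continuous kernel whose Hilbert space separates the closed sets of a `T₁` space is completely
separating, and its metric induces the topology. -/
theorem completelySeparating_of_separates_closed {X H : Type*} [TopologicalSpace X] [T1Space X]
    [NormedAddCommGroup H] [InnerProductSpace ℂ H] [CompleteSpace H] [RKHS ℂ H X ℂ]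
    (hk : Continuous (kernelVector (X := X) H)) (hsep : ∀ C : Set X, IsClosed C → SeparatesOf H C) :
    (kernelMetricOf (X := X) H).toUniformSpace.toTopologicalSpace = ‹TopologicalSpace X› ∧
      CompletelySeparatingOf (X := X) H := by
  have htop : (kernelMetricOf (X := X) H).toUniformSpace.toTopologicalSpace =
      ‹TopologicalSpace X› := by
    refine le_antisymm ?_ (continuous_iff_le_induced.1 hk)
    intro U hU
    exact (@isClosed_compl_iff _ (_) U).1
      (isClosed_kernelMetricOf_of_separates (hsep Uᶜ hU.isClosed_compl))
  refine ⟨htop, fun x y hxy => ?_, fun C hC => hsep C (htop ▸ hC)⟩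
  by_contra hne
  obtain ⟨f, hf, hf0⟩ := hsep {y} isClosed_singleton x hne
  refine hf ?_
  rw [← inner_kernelVector, hxy, inner_kernelVector]
  exact hf0 y rfl

open MeasureTheory in
/-- Every Schwartz function is of the form `y ↦ ⟨e y, g⟩` for the feature map
`e y = √r e^{-2πi z·y}` of a kernel with Fourier transform `r`. -/
theorem exists_inner_featureMap_eq {V : Type*} [NormedAddCommGroup V] [InnerProductSpace ℝ V]
    [FiniteDimensional ℝ V] [MeasurableSpace V] [BorelSpace V]
    {r : V → ℝ} (hr : Continuous r) {a b γ₁ γ₂ : ℝ}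
    (ha : 0 < a) (hb : 0 < b) (hγ₁ : 0 < γ₁) (hγ₂ : 0 < γ₂)
    (h : ∀ z, a / (1 + b * ‖z‖ ^ γ₁) ^ γ₂ ≤ r z)
    {e : V → Lp ℂ 2 (volume : Measure V)}
    (he : ∀ x, e x =ᵐ[volume] fun z => 𝐞 (-⟪z, x⟫_ℝ) • (√(r z) : ℂ)) (φ : SchwartzMap V ℂ) :
    ∃ g : Lp ℂ 2 (volume : Measure V), ∀ y, ⟪e y, g⟫_ℂ = φ y := by
  -- The witness is 𝓕 φ / √r: pairing with e y cancels √r and leaves the inverse Fourier integral of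
  -- 𝓕 φ at y.
  have hg := memLp_schwartz_div_sqrt hr ha hb hγ₁ hγ₂ h (𝓕 φ)
  refine ⟨hg.toLp _, fun y => ?_⟩
  have hinv : 𝓕⁻ (𝓕 (φ : V → ℂ)) y = φ y :=
    φ.integrable.fourierInv_fourier_eq (SchwartzMap.integrable (𝓕 φ))
      φ.continuous.continuousAt
  rw [← hinv, L2.inner_def, Real.fourierInv_eq]
  refine integral_congr_ae ?_
  filter_upwards [he y, hg.coeFn_toLp] with z h1 h2
  have hz : (√(r z) : ℂ) ≠ 0 := by
    have : 0 < r z := lt_of_lt_of_le (by positivity) (h z)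
    exact_mod_cast (Real.sqrt_pos.2 this).ne'
  rw [h1, h2, RCLike.inner_apply, ← SchwartzMap.fourier_coe]
  simp only [Circle.smul_def, smul_eq_mul, map_mul, Complex.conj_ofReal,
    ← Circle.coe_inv_eq_conj, ← AddChar.map_neg_eq_inv, neg_neg]
  field_simp

theorem separatesOf_of_schwartz {V H : Type*} [NormedAddCommGroup V] [InnerProductSpace ℝ V]
    [FiniteDimensional ℝ V] [NormedAddCommGroup H] [InnerProductSpace ℂ H] [CompleteSpace H]
    [RKHS ℂ H V ℂ] (h : ∀ φ : SchwartzMap V ℂ, ∃ f : H, ∀ y, f y = φ y)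
    {C : Set V} (hC : IsClosed C) : SeparatesOf H C := by
  intro x hx
  obtain ⟨φ, hsupp, hφc, hφ, -, hφx⟩ :=
    exists_contDiff_tsupport_subset (n := ⊤) (hC.isOpen_compl.mem_nhds hx)
  have hc : HasCompactSupport fun y => (φ y : ℂ) :=
    hφc.comp_left (g := fun t : ℝ => (t : ℂ)) Complex.ofReal_zero
  have hs : ContDiff ℝ ((⊤ : ℕ∞) : WithTop ℕ∞) fun y => (φ y : ℂ) :=
    Complex.ofRealCLM.contDiff.comp hφ
  obtain ⟨f, hf⟩ := h (hc.toSchwartzMap hs)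
  have hfφ : ∀ y, f y = φ y := fun y => hf y
  refine ⟨f, by simp [hfφ, hφx], fun y hy => ?_⟩
  rw [hfφ, image_eq_zero_of_notMem_tsupport fun hy' => hsupp hy' hy, Complex.ofReal_zero]

open MeasureTheory in
/-- The Hilbert space of a kernel with a Fourier transform of at most polynomial decay contains
the test functions, hence separates closed sets. -/
theorem separatesOf_of_fourier {V H : Type*} [NormedAddCommGroup V] [InnerProductSpace ℝ V]
    [FiniteDimensional ℝ V] [MeasurableSpace V] [BorelSpace V]
    [NormedAddCommGroup H] [InnerProductSpace ℂ H] [CompleteSpace H] [RKHS ℂ H V ℂ]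
    {r : V → ℝ} (hr : Continuous r) {a b γ₁ γ₂ : ℝ}
    (ha : 0 < a) (hb : 0 < b) (hγ₁ : 0 < γ₁) (hγ₂ : 0 < γ₂)
    (h : ∀ z, a / (1 + b * ‖z‖ ^ γ₁) ^ γ₂ ≤ r z)
    {e : V → Lp ℂ 2 (volume : Measure V)}
    (he : ∀ x, e x =ᵐ[volume] fun z => 𝐞 (-⟪z, x⟫_ℝ) • (√(r z) : ℂ))
    (hin : ∀ x y, ⟪kernelVector H x, kernelVector H y⟫_ℂ = ⟪e x, e y⟫_ℂ)
    {C : Set V} (hC : IsClosed C) : SeparatesOf H C := by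
  refine separatesOf_of_schwartz (fun φ => ?_) hC
  obtain ⟨g, hg⟩ := exists_inner_featureMap_eq hr ha hb hγ₁ hγ₂ h he φ
  obtain ⟨f, hf⟩ := exists_inner_eq_of_inner_eq (kernelVector H) e hin g
  exact ⟨f, fun y => by rw [← inner_kernelVector, hf, hg]⟩

theorem inner_kernelVector_ofKernel {X : Type*} {K : X → X → ℂ}
    [Fact (opKernel K).PosSemidef] (x y : X) :
    ⟪kernelVector (RKHS.OfKernel (opKernel K)) x,
      kernelVector (RKHS.OfKernel (opKernel K)) y⟫_ℂ = K x y := by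
  rw [inner_kernelVector, kernelVector, RKHS.kerFun_apply, RKHS.OfKernel.kernel_ofKernel]
  simp [opKernel]

theorem continuous_kernelVector_ofKernel {X : Type*} [TopologicalSpace X] {K : X → X → ℂ}
    [Fact (opKernel K).PosSemidef] (hK : Continuous fun p : X × X => K p.1 p.2) :
    Continuous (kernelVector (X := X) (RKHS.OfKernel (opKernel K))) := by
  refine continuous_iff_continuousAt.2 fun x => ?_
  refine tendsto_iff_norm_sub_tendsto_zero.2 ?_
  have key : ∀ y, ‖kernelVector (RKHS.OfKernel (opKernel K)) y -
      kernelVector (RKHS.OfKernel (opKernel K)) x‖ =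
      √(RCLike.re (K y y - K y x - (K x y - K x x))) := by
    intro y
    rw [norm_eq_sqrt_re_inner (𝕜 := ℂ)]
    simp only [inner_sub_left, inner_sub_right, inner_kernelVector_ofKernel]
    congr 2
    ring
  simp_rw [key]
  have h1 : Continuous fun y => √(RCLike.re (K y y - K y x - (K x y - K x x))) := by
    have e1 : Continuous fun y => K y y := hK.comp (by fun_prop : Continuous fun y : X => (y, y))
    have e2 : Continuous fun y => K y x := hK.comp (by fun_prop : Continuous fun y : X => (y, x))
    have e3 : Continuous fun y => K x y := hK.comp (by fun_prop : Continuous fun y : X => (x, y))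
    fun_prop
  simpa using h1.tendsto x

end SeparatingKernel

theorem mainTheorem4 (d : ℕ) (K : EuclideanSpace ℝ (Fin d) → ℂ)
    (hcont : Continuous K) (hint : MeasureTheory.Integrable K MeasureTheory.volume)
    (a b γ₁ γ₂ : ℝ) (ha : 0 < a) (hb : 0 < b) (hγ₁ : 0 < γ₁) (hγ₂ : 0 < γ₂)
    (hK : ∀ z : EuclideanSpace ℝ (Fin d),
      ((a / (1 + b * ‖z‖ ^ γ₁) ^ γ₂ : ℝ) : ℂ) ≤ 𝓕 K z) :
    ∃ hpos : SeparatingKernel.IsPositiveDefinite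
        (fun x y : EuclideanSpace ℝ (Fin d) => K (x - y)),
      Continuous (fun p : EuclideanSpace ℝ (Fin d) × EuclideanSpace ℝ (Fin d) =>
        K (p.1 - p.2)) ∧
      ((∀ x y, (SeparatingKernel.kernelMetric hpos).dist x y = 0 → x = y) ∧
        SeparatingKernel.kernelTopology hpos =
          (inferInstance : TopologicalSpace (EuclideanSpace ℝ (Fin d)))) ∧
      SeparatingKernel.CompletelySeparating hpos := by
  have hlow : ∀ z : EuclideanSpace ℝ (Fin d), 0 < a / (1 + b * ‖z‖ ^ γ₁) ^ γ₂ :=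
    fun z => by positivity
  have h0 : ∀ z, 0 ≤ 𝓕 K z := fun z => (Complex.zero_le_real.2 (hlow z).le).trans (hK z)
  let r : EuclideanSpace ℝ (Fin d) → ℝ := fun z => (𝓕 K z).re
  -- Being ≥ 0 in the order of ℂ includes having zero imaginary part.
  have hrK : ∀ z, 𝓕 K z = r z := fun z =>
    Complex.ext rfl (by simpa using (Complex.le_def.1 (h0 z)).2.symm)
  have hr0 : ∀ z, 0 ≤ r z := fun z => (Complex.le_def.1 (h0 z)).1
  have hr : Continuous r := Complex.continuous_re.comp (continuous_fourier_of_integrable hint)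
  have hlow' : ∀ z, a / (1 + b * ‖z‖ ^ γ₁) ^ γ₂ ≤ r z := fun z => by
    have := hK z
    rw [hrK] at this
    exact_mod_cast this
  have hF := integrable_fourier_of_nonneg hint hcont.continuousAt h0
  obtain ⟨e, he, hin⟩ := exists_featureMap hcont hint hF hr hr0 hrK
  have hpos : SeparatingKernel.IsPositiveDefinite
      (fun x y : EuclideanSpace ℝ (Fin d) => K (x - y)) := by
    have := posSemidef_of_inner e
    simp_rw [hin] at this
    exact this
  have hc : Continuous (fun p : EuclideanSpace ℝ (Fin d) × EuclideanSpace ℝ (Fin d) =>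
      K (p.1 - p.2)) := by fun_prop
  have : Fact (SeparatingKernel.opKernel
      (fun x y : EuclideanSpace ℝ (Fin d) => K (x - y))).PosSemidef :=
    ⟨SeparatingKernel.opKernel_posSemidef hpos⟩
  have hmain := SeparatingKernel.completelySeparating_of_separates_closed
    (SeparatingKernel.continuous_kernelVector_ofKernel
      (K := fun x y : EuclideanSpace ℝ (Fin d) => K (x - y)) hc)
    (fun C hC => SeparatingKernel.separatesOf_of_fourier hr ha hb hγ₁ hγ₂ hlow' he
      (fun x y => by rw [SeparatingKernel.inner_kernelVector_ofKernel, hin]) hC)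
  refine ⟨hpos, hc, ⟨fun x y hxy => hmain.2.1 ?_, hmain.1⟩, hmain.2⟩
  exact dist_eq_zero.1 hxy
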